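/- Agents $i\in\mathbb P$ communicate over a network of directed channels and share a global clock with values in $\mathbb N$. A *context* $\gamma$ fixes the channels; for each channel $i\mapsto j$ a lower bound $\mathit{min}_{ij}\ge 1$ and an upper bound $b_{ij}\in\mathbb N\cup\{\infty\}$ with $\mathit{min}_{ij}\le b_{ij}$ on transmission times; the possible initial states; the possible external inputs of each agent; the transition function of local states; and whether all messages must eventually be delivered (messages over channels with $b_{ij}<\infty$ are always delivered). The *Asynch-delivery* contexts $\gamma^{\mathsf{as}}$ are those in which $b_{ij}=\infty$ for every channel. The local state $r_i(t)$ of agent $i$ at time $t$ in a run $r$ consists of the clock value $t$ and data. The data at time $0$ is determined by the initial state and the external inputs of $i$ at time $0$; the data at time $t+1$ is determined by the local state and the action of $i$ at time $t$ and by the external inputs and messages that $i$ receives at time $t+1$. A protocol $P$ assigns to every agent and local state a nonempty set of allowed actions (a single one, if $P$ is deterministic); an action is an internal action together with a finite set of messages sent on each channel. External inputs occur nondeterministically: at each node a finite (possibly empty) set of possible inputs may arrive, each input of an agent occurring at most once in a run. A sent message is received at most once, at a nondeterministic time respecting the bounds; it is identified by its sender, destination, sending time and content. The system $\mathcal R(P,\gamma)$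 is the set of all runs of $P$ in $\gamma$. An *ND event* at a node $(j,t)$ of $r$ is an external input to $j$ at time $t$, or an *early receive* by $j$ at time $t$: the receipt of a message strictly before the upper bound of its channel has elapsed since it was sent. The fact $\mathsf{ndocc}(e)$ holds at $(r,t)$ if $e$ occurs as an ND event in $r$ at some time $\le t$. For a system $\mathcal R$, $(\mathcal R,r,t)\vDash K_i\varphi$ means that $(\mathcal R,r',s)\vDash\varphi$ for all $r'\in\mathcal R$ and $s$ with $r'_i(s)=r_i(t)$. *Lamport's happened-before relation* $\twoheadrightarrow$ of $r$ is the smallest transitive relation on nodes $(i,t)\in\mathbb P\times\mathbb N$ such that $(i,t)\twoheadrightarrow(i,t')$ whenever $t\le t'$, and $(i,t)\twoheadrightarrow(j,t')$ whenever a message sent at $(i,t)$ is received at $(j,t')$ in $r$. **Lemma.** Let $P$ be an arbitrary protocol, $\gamma^{\mathsf{as}}$ an Asynch-delivery context, $\mathcal R^{\mathsf{as}}=\mathcal R(P,\gamma^{\mathsf{as}})$ and $r\in\mathcal R^{\mathsf{as}}$. Let $k\ge 0$, $i_0,\dots,i_k\in\mathbb P$ and $t,t'\in\mathbb N$, and let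 $e$ be an ND event occurring at $(i_0,t)$ in $r$. If $$(\mathcal R^{\mathsf{as}},r,t')\vDash K_{i_k}K_{i_{k-1}}\cdots K_{i_1}\mathsf{ndocc}(e),$$ then there are times $t_0=t$ and $t_1,\dots,t_k$ with $t\le t_h\le t'$ for all $0\le h\le k$ such that $$(i_0,t)\twoheadrightarrow(i_1,t_1)\twoheadrightarrow\cdots\twoheadrightarrow(i_k,t_k)\quad\text{in } r.$$ -/

import Mathlib

/-! Message-passing systems whose agents share a global clock, in which the transmission time of
a message on the channel from `i` to `j` lies between `lo i j` and `hi i j`, where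
`hi i j = ⊤` means that there is no upper bound.

Type parameters: `P` agents, `X` external inputs, `M` message contents, `A` internal actions,
`S` data part of the local states. -/

namespace KnowledgeGain

/-- A message, identified by its sender, destination, sending time and content. -/
structure Message (P M : Type*) where
  src : P
  dst : P
  sentAt : ℕ
  content : M

/-- What one agent does in one step: an internal action, and for every `j` the finite set of
contents that it sends to `j`. -/
structure Action (P M A : Type*) where
  internal : A
  send : P → Finset M

/-- A local state. It shows the global clock. -/
structure LocalState (S : Type*) where
  clock : ℕ
  data : S

/-- A context: the network with its transmission bounds, the possible initial states, the possible
external inputs of each agent, and the transition function of local states. -/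
structure Context (P X M A S : Type*) where
  /-- `channel i j`: there is a directed channel from `i` to `j`. -/
  channel : P → P → Prop
  /-- Lower bound on transmission times. -/
  lo : P → P → ℕ
  /-- Upper bound on transmission times; `⊤` means unbounded. -/
  hi : P → P → ℕ∞
  one_le_lo : ∀ i j, channel i j → 1 ≤ lo i j
  lo_le_hi : ∀ i j, channel i j → (lo i j : ℕ∞) ≤ hi i j
  /-- Whether every message has to be delivered eventually, on unbounded channels too. -/
  reliable : Prop
  /-- The possible joint initial states, before the external inputs of time `0`. -/
  initial : Set (P → S)
  /-- The external inputs that may arrive at each agent. -/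
  inputs : P → Set X
  /-- The data at time `0`, from the initial state and the external inputs at time `0`. -/
  start : P → S → Finset X → S
  /-- The data at time `t + 1`, from the local state and the action at time `t`, the external
  inputs at time `t + 1`, and the messages received at time `t + 1`. -/
  next : P → LocalState S → Action P M A → Finset X → Set (Message P M) → S

/-- The asynchronous-delivery contexts: all upper bounds are infinite. -/
def Context.IsAsynch {P X M A S : Type*} (γ : Context P X M A S) : Prop :=
  ∀ i j, γ.channel i j → γ.hi i j = ⊤

/-- A (possibly nondeterministic) protocol: the actions allowed to an agent in a local state.
A deterministic protocol is one where these sets are singletons. -/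
structure Protocol (P M A S : Type*) where
  allowed : P → LocalState S → Set (Action P M A)
  allowed_nonempty : ∀ i s, (allowed i s).Nonempty

/-- The data of a run; `input i t` are the external inputs that occur at node `(i, t)`, and
`delivered t` are the messages received at time `t` (by their respective destinations). -/
structure Run (P X M A S : Type*) where
  init : P → S
  input : P → ℕ → Finset X
  delivered : ℕ → Set (Message P M)
  action : P → ℕ → Action P M A
  data : P → ℕ → S

section
variable {P X M A S : Type*}

/-- The local state of `i` at time `t`. -/
def Run.localState (r : Run P X M A S) (i : P) (t : ℕ) : LocalState S :=
  ⟨t, r.data i t⟩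

/-- The messages received at the node `(i, t)`. -/
def Run.inbox (r : Run P X M A S) (i : P) (t : ℕ) : Set (Message P M) :=
  {m | m.dst = i ∧ m ∈ r.delivered t}

/-- The message `m` is sent in `r` (at the node `(m.src, m.sentAt)`, over a channel). -/
def Run.Sent (γ : Context P X M A S) (r : Run P X M A S) (m : Message P M) : Prop :=
  γ.channel m.src m.dst ∧ m.content ∈ (r.action m.src m.sentAt).send m.dst

/-- `r` is a run of the protocol `p` in the context `γ`. -/
structure IsRun (p : Protocol P M A S) (γ : Context P X M A S) (r : Run P X M A S) : Prop where
  init_mem : r.init ∈ γ.initial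
  data_zero : ∀ i, r.data i 0 = γ.start i (r.init i) (r.input i 0)
  data_succ : ∀ i t, r.data i (t + 1) =
    γ.next i (r.localState i t) (r.action i t) (r.input i (t + 1)) (r.inbox i (t + 1))
  action_mem : ∀ i t, r.action i t ∈ p.allowed i (r.localState i t)
  input_mem : ∀ i t, ∀ x ∈ r.input i t, x ∈ γ.inputs i
  /-- Events of a run are distinct: an external input of `i` occurs at most once. -/
  input_once : ∀ i t s x, x ∈ r.input i t → x ∈ r.input i s → t = s
  delivered_sent : ∀ t, ∀ m ∈ r.delivered t, r.Sent γ m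
  delivered_once : ∀ t s m, m ∈ r.delivered t → m ∈ r.delivered s → t = s
  lo_le_delay : ∀ t, ∀ m ∈ r.delivered t, m.sentAt + γ.lo m.src m.dst ≤ t
  delay_le_hi : ∀ t, ∀ m ∈ r.delivered t, (t : ℕ∞) ≤ m.sentAt + γ.hi m.src m.dst
  exists_delivered : ∀ m, r.Sent γ m → (γ.reliable ∨ γ.hi m.src m.dst ≠ ⊤) →
    ∃ t, m ∈ r.delivered t

/-- The system `R(p, γ)` of all runs of `p` in `γ`. -/
def system (p : Protocol P M A S) (γ : Context P X M A S) : Set (Run P X M A S) :=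
  {r | IsRun p γ r}

/-- Events governed by the environment: the external input `x` at `i`, and the receipt of a
message `m` (by `m.dst`). An event may happen at different times in different runs. -/
inductive Event (P X M : Type*) where
  | input (i : P) (x : X)
  | receive (m : Message P M)

/-- `e` is a nondeterministic event that occurs at the node `(j, t)` of `r`: an external input, or
an early receive, i.e. the receipt of a message strictly before its upper bound has elapsed. -/
def NDOccursAt (γ : Context P X M A S) (r : Run P X M A S) (j : P) (t : ℕ) :
    Event P X M → Prop
  | .input i x => i = j ∧ x ∈ r.input j t
  | .receive m => m ∈ r.inbox j t ∧ (t : ℕ∞) < m.sentAt + γ.hi m.src m.dst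

/-- The fact `ndocc(e)`, at the point `(r, t)`: `e` has occurred as a nondeterministic event by
time `t`. -/
def ndocc (γ : Context P X M A S) (e : Event P X M) (r : Run P X M A S) (t : ℕ) : Prop :=
  ∃ j, ∃ s ≤ t, NDOccursAt γ r j s e

/-- `Knows R i φ` holds at the point `(r, t)` if the fact `φ` holds at all points of `R` at which
`i` has the same local state as at `(r, t)`. -/
def Knows (R : Set (Run P X M A S)) (i : P) (φ : Run P X M A S → ℕ → Prop)
    (r : Run P X M A S) (t : ℕ) : Prop :=
  ∀ r' ∈ R, ∀ t', r'.localState i t' = r.localState i t → φ r' t'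

/-- `NestedKnows R i k φ` is the fact `K_{i k} K_{i (k-1)} ⋯ K_{i 1} φ`
(it is `φ` for `k = 0`). -/
def NestedKnows (R : Set (Run P X M A S)) (i : ℕ → P) :
    ℕ → (Run P X M A S → ℕ → Prop) → Run P X M A S → ℕ → Prop
  | 0, φ => φ
  | k + 1, φ => Knows R (i (k + 1)) (NestedKnows R i k φ)

/-- Lamport's happened-before relation on the process-time nodes of a run. -/
inductive HappenedBefore (r : Run P X M A S) : P × ℕ → P × ℕ → Prop where
  | loc (i : P) (t t' : ℕ) : t ≤ t' → HappenedBefore r (i, t) (i, t')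
  | msg (m : Message P M) (t : ℕ) : m ∈ r.delivered t →
      HappenedBefore r (m.src, m.sentAt) (m.dst, t)
  | trans (a b c : P × ℕ) : HappenedBefore r a b → HappenedBefore r b c → HappenedBefore r a c

end

end KnowledgeGain

namespace KnowledgeGain

section
variable {P X M A S : Type*}

/-! Without upper bounds, anything outside the causal past `Q` of `(i (k + 1), t')` can be
suppressed up to time `t'`: inputs are dropped and deliveries postponed. The result, `silenced`, is
again a run (`isRun_silenced`), and `i (k + 1)` cannot tell it from `r` at `t'`
(`silenced_localState_of_mem`). Hence the inner knowledge holds in the silenced run, where induction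
on `k` yields a chain for the first `k` agents.

The chain must end inside `Q` to be prolonged to `i (k + 1)`. A bare time on the timeline of `i k`
need not lie in `Q`, so the induction asks in addition that all chain nodes be active: up to `t'`,
the silenced run has active nodes only in `Q` (`silenced_active`). Causality up to `t'` carries back
to `r` (`happenedBefore_of_silenced`). -/

/-- Causality respects the clock. -/
theorem HappenedBefore.time_le {p : Protocol P M A S} {γ : Context P X M A S}
    {r : Run P X M A S} (hr : IsRun p γ r) {a b : P × ℕ} (h : HappenedBefore r a b) :
    a.2 ≤ b.2 := by
  induction h with
  | loc i t t' h => exact h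
  | msg m t hm => exact (Nat.le_add_right _ _).trans (hr.lo_le_delay t m hm)
  | trans a b c _ _ h₁ h₂ => exact h₁.trans h₂

/-- The node receives an external input or a message. -/
def Run.Active (r : Run P X M A S) (n : P × ℕ) : Prop :=
  (r.input n.1 n.2).Nonempty ∨ (r.inbox n.1 n.2).Nonempty

theorem NDOccursAt.active {γ : Context P X M A S} {r : Run P X M A S} {j : P} {t : ℕ}
    {e : Event P X M} (h : NDOccursAt γ r j t e) : r.Active (j, t) := by
  cases e with
  | input i x => exact Or.inl ⟨x, h.2⟩
  | receive m => exact Or.inr ⟨m, h.1⟩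

/-- A nondeterministic event occurs at most once in a run. -/
theorem NDOccursAt.unique {p : Protocol P M A S} {γ : Context P X M A S} {r : Run P X M A S}
    (hr : IsRun p γ r) {j j' : P} {t t' : ℕ} {e : Event P X M}
    (h : NDOccursAt γ r j t e) (h' : NDOccursAt γ r j' t' e) : j = j' ∧ t = t' := by
  cases e with
  | input i x =>
    obtain ⟨rfl, hx⟩ := h
    obtain ⟨rfl, hx'⟩ := h'
    exact ⟨rfl, hr.input_once _ _ _ _ hx hx'⟩
  | receive m =>
    exact ⟨h.1.1.symm.trans h'.1.1, hr.delivered_once _ _ _ h.1.2 h'.1.2⟩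

/-- Causality either stays on the agent's own timeline or enters it at an active node. -/
theorem HappenedBefore.local_or_active {r : Run P X M A S} {a b : P × ℕ}
    (h : HappenedBefore r a b) :
    (a.1 = b.1 ∧ a.2 ≤ b.2) ∨
      ∃ s ≤ b.2, r.Active (b.1, s) ∧ HappenedBefore r a (b.1, s) := by
  induction h with
  | loc i t t' h => exact Or.inl ⟨rfl, h⟩
  | msg m t hm => exact Or.inr ⟨t, le_rfl, Or.inr ⟨m, rfl, hm⟩, .msg m t hm⟩
  | trans a b c hab _ h₁ h₂ =>
    rcases h₂ with ⟨hbc, hle⟩ | ⟨s, hs, hact, hb⟩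
    · rcases h₁ with ⟨hab', hle'⟩ | ⟨s, hs, hact, ha⟩
      · exact Or.inl ⟨hab'.trans hbc, hle'.trans hle⟩
      -- The second leg is local, so the active node found on the first leg already lies on the
      -- target timeline.
      · exact Or.inr ⟨s, hs.trans hle, hbc ▸ hact, hbc ▸ ha⟩
    · exact Or.inr ⟨s, hs, hact, .trans _ _ _ hab hb⟩

/-- The causal future of an active node reaches any agent first at an active node. -/
theorem HappenedBefore.exists_active {r : Run P X M A S} {a : P × ℕ} {j : P} {s : ℕ}
    (h : HappenedBefore r a (j, s)) (ha : r.Active a) :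
    ∃ s' ≤ s, r.Active (j, s') ∧ HappenedBefore r a (j, s') := by
  rcases h.local_or_active with ⟨rfl, hle⟩ | h
  · exact ⟨a.2, hle, ha, .loc _ _ _ le_rfl⟩
  · exact h

/-- A set of nodes closed under causal predecessors, up to the time `T`. -/
structure IsCausalPast (r : Run P X M A S) (T : ℕ) (Q : Set (P × ℕ)) : Prop where
  time_le : ∀ n ∈ Q, n.2 ≤ T
  pred : ∀ i t, (i, t + 1) ∈ Q → (i, t) ∈ Q
  sender : ∀ t, ∀ m ∈ r.delivered t, (m.dst, t) ∈ Q → (m.src, m.sentAt) ∈ Q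

theorem isCausalPast_setOf_happenedBefore {p : Protocol P M A S} {γ : Context P X M A S}
    {r : Run P X M A S} (hr : IsRun p γ r) (i : P) (T : ℕ) :
    IsCausalPast r T {n | HappenedBefore r n (i, T)} where
  time_le _ hn := HappenedBefore.time_le hr hn
  pred _ t hn := .trans _ _ _ (.loc _ t (t + 1) t.le_succ) hn
  sender t m hm hn := .trans _ _ _ (.msg m t hm) hn

/-! ### Silencing a run outside a causal past

Outside the nodes of `Q` nothing is received up to time `T` and no external input arrives; the
messages not received in `Q` are delivered after time `T`. -/

section Silence
variable (p : Protocol P M A S) (γ : Context P X M A S) (r : Run P X M A S) (T : ℕ)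
  (Q : Set (P × ℕ))

open Classical in
/-- The external inputs at the nodes of `Q`. -/
noncomputable def silencedInput (j : P) (s : ℕ) : Finset X :=
  if (j, s) ∈ Q then r.input j s else ∅

open Classical in
/-- The actions of `r` at the nodes of `Q`, and arbitrary allowed ones elsewhere. -/
noncomputable def silencedAction (s : ℕ) (data : P → S) (j : P) : Action P M A :=
  if (j, s) ∈ Q then r.action j s else (p.allowed_nonempty j ⟨s, data j⟩).some

/-- The messages received at time `s`, given the set of messages sent before. -/
def silencedDelivered (s : ℕ) (sent : Set (Message P M)) : Set (Message P M) :=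
  {m | (m ∈ r.delivered s ∧ (m.dst, s) ∈ Q) ∨
    -- The postponed receipts, at the earliest time after `T` that respects the lower bound.
    (m ∈ sent ∧ (∀ u, m ∈ r.delivered u → (m.dst, u) ∉ Q) ∧
      s = max (T + 1) (m.sentAt + γ.lo m.src m.dst))}

/-- The data at each time, together with the set of messages sent before that time. -/
noncomputable def silencedHistory : ℕ → (P → S) × Set (Message P M)
  | 0 => (fun j => γ.start j (r.init j) (silencedInput r Q j 0), ∅)
  | n + 1 =>
    let data := (silencedHistory n).1
    let act := silencedAction p r Q n data
    -- Outside `Q` agents may send messages that `r` lacks, so the sent messages are recorded during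
    -- the recursion.
    let sent := (silencedHistory n).2 ∪
      {m | m.sentAt = n ∧ γ.channel m.src m.dst ∧ m.content ∈ (act m.src).send m.dst}
    (fun j => γ.next j ⟨n, data j⟩ (act j) (silencedInput r Q j (n + 1))
      {m | m.dst = j ∧ m ∈ silencedDelivered γ r T Q (n + 1) sent}, sent)

/-- The run `r` silenced outside `Q`. -/
noncomputable def silenced : Run P X M A S where
  init := r.init
  input := silencedInput r Q
  delivered s := silencedDelivered γ r T Q s (silencedHistory p γ r T Q s).2
  action j s := silencedAction p r Q s (silencedHistory p γ r T Q s).1 j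
  data j s := (silencedHistory p γ r T Q s).1 j

theorem mem_silencedHistory_sent (n : ℕ) (m : Message P M) :
    m ∈ (silencedHistory p γ r T Q n).2 ↔
      (silenced p γ r T Q).Sent γ m ∧ m.sentAt < n := by
  induction n with
  | zero => simp [silencedHistory]
  | succ n ih =>
    simp only [silencedHistory, Set.mem_union, Set.mem_ofPred_eq, ih]
    constructor
    · rintro (⟨h, hlt⟩ | ⟨rfl, h⟩)
      · exact ⟨h, hlt.trans n.lt_succ_self⟩
      · exact ⟨h, Nat.lt_succ_self _⟩
    · rintro ⟨h, hlt⟩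
      rcases Nat.lt_succ_iff_lt_or_eq.1 hlt with hlt | rfl
      · exact Or.inl ⟨h, hlt⟩
      · exact Or.inr ⟨rfl, h⟩

variable {p γ r T Q}

/-! ### Comparison of the silenced run with the original -/

theorem silenced_action_of_mem {j : P} {s : ℕ} (h : (j, s) ∈ Q) :
    (silenced p γ r T Q).action j s = r.action j s := if_pos h

theorem silenced_input_of_mem {j : P} {s : ℕ} (h : (j, s) ∈ Q) :
    (silenced p γ r T Q).input j s = r.input j s := if_pos h

theorem mem_of_mem_silenced_input {j : P} {s : ℕ} {x : X}
    (h : x ∈ (silenced p γ r T Q).input j s) : (j, s) ∈ Q ∧ x ∈ r.input j s := by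
  change x ∈ silencedInput r Q j s at h
  unfold silencedInput at h
  split_ifs at h with hq
  · exact ⟨hq, h⟩
  · simp at h

theorem mem_silenced_delivered {s : ℕ} {m : Message P M} :
    m ∈ (silenced p γ r T Q).delivered s ↔ (m ∈ r.delivered s ∧ (m.dst, s) ∈ Q) ∨
      (((silenced p γ r T Q).Sent γ m ∧ m.sentAt < s) ∧
        (∀ u, m ∈ r.delivered u → (m.dst, u) ∉ Q) ∧
        s = max (T + 1) (m.sentAt + γ.lo m.src m.dst)) := by
  rw [← mem_silencedHistory_sent]
  rfl

theorem mem_silenced_delivered_of_le {s : ℕ} (hs : s ≤ T) {m : Message P M} :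
    m ∈ (silenced p γ r T Q).delivered s ↔ m ∈ r.delivered s ∧ (m.dst, s) ∈ Q := by
  rw [mem_silenced_delivered, or_iff_left]
  rintro ⟨-, -, h⟩
  have := le_max_left (T + 1) (m.sentAt + γ.lo m.src m.dst)
  omega

theorem silenced_inbox_of_mem (hQ : IsCausalPast r T Q) {j : P} {s : ℕ} (h : (j, s) ∈ Q) :
    (silenced p γ r T Q).inbox j s = r.inbox j s := by
  ext m
  simp only [Run.inbox, Set.mem_ofPred_eq, mem_silenced_delivered_of_le (hQ.time_le _ h)]
  constructor
  · rintro ⟨h₁, h₂, -⟩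
    exact ⟨h₁, h₂⟩
  · rintro ⟨rfl, h₂⟩
    exact ⟨rfl, h₂, h⟩

theorem silenced_data_succ (j : P) (s : ℕ) :
    (silenced p γ r T Q).data j (s + 1) =
      γ.next j ((silenced p γ r T Q).localState j s) ((silenced p γ r T Q).action j s)
        ((silenced p γ r T Q).input j (s + 1)) ((silenced p γ r T Q).inbox j (s + 1)) := rfl

/-- Agents cannot distinguish a run from the silenced one at the nodes of `Q`. -/
theorem silenced_localState_of_mem (hr : IsRun p γ r) (hQ : IsCausalPast r T Q) {j : P} {s : ℕ}
    (h : (j, s) ∈ Q) : (silenced p γ r T Q).localState j s = r.localState j s := by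
  induction s with
  | zero =>
    have h₀ : (silenced p γ r T Q).data j 0 =
      γ.start j (r.init j) ((silenced p γ r T Q).input j 0) := rfl
    simp only [Run.localState, h₀, silenced_input_of_mem h, hr.data_zero]
  | succ s ih =>
    have h' := hQ.pred _ _ h
    have hd : (silenced p γ r T Q).data j (s + 1) = r.data j (s + 1) := by
      rw [silenced_data_succ, hr.data_succ, ih h', silenced_action_of_mem h',
        silenced_input_of_mem h, silenced_inbox_of_mem hQ h]
    simp only [Run.localState, hd]

/-- Asynchrony makes postponement legal. A message received in `Q` was sent from `Q`, where actions
are unchanged; every other sent message is delivered late, so even reliability holds. -/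
theorem isRun_silenced (hγ : γ.IsAsynch) (hr : IsRun p γ r) (hQ : IsCausalPast r T Q) :
    IsRun p γ (silenced p γ r T Q) := by
  have hsent : ∀ t, ∀ m ∈ (silenced p γ r T Q).delivered t,
      (silenced p γ r T Q).Sent γ m := by
    intro t m hm
    rcases mem_silenced_delivered.1 hm with ⟨hm, hq⟩ | ⟨⟨hm, -⟩, -⟩
    · have := hr.delivered_sent t m hm
      refine ⟨this.1, ?_⟩
      rw [silenced_action_of_mem (hQ.sender t m hm hq)]
      exact this.2
    · exact hm
  refine
    { init_mem := hr.init_mem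
      data_zero := fun _ => rfl
      data_succ := silenced_data_succ
      action_mem := ?_
      input_mem := ?_
      input_once := ?_
      delivered_sent := hsent
      delivered_once := ?_
      lo_le_delay := ?_
      delay_le_hi := ?_
      exists_delivered := ?_ }
  · intro j s
    by_cases h : (j, s) ∈ Q
    · rw [silenced_action_of_mem h, silenced_localState_of_mem hr hQ h]
      exact hr.action_mem j s
    · change silencedAction p r Q s _ j ∈ _
      rw [silencedAction, if_neg h]
      exact Set.Nonempty.some_mem _
  · exact fun j s x hx => hr.input_mem j s x (mem_of_mem_silenced_input hx).2
  · exact fun j t s x ht hs => hr.input_once j t s x (mem_of_mem_silenced_input ht).2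
      (mem_of_mem_silenced_input hs).2
  · intro t s m ht hs
    rcases mem_silenced_delivered.1 ht with ⟨ht, hqt⟩ | ⟨-, ht, ht'⟩ <;>
      rcases mem_silenced_delivered.1 hs with ⟨hs, hqs⟩ | ⟨-, hs, hs'⟩
    · exact hr.delivered_once t s m ht hs
    · exact absurd hqt (hs t ht)
    · exact absurd hqs (ht s hs)
    · exact ht'.trans hs'.symm
  · intro t m hm
    rcases mem_silenced_delivered.1 hm with ⟨hm, -⟩ | ⟨-, -, rfl⟩
    · exact hr.lo_le_delay t m hm
    · exact le_max_right _ _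
  · intro t m hm
    rw [hγ _ _ (hsent t m hm).1, add_top]
    exact le_top
  · intro m hm _
    by_cases h : ∃ u, m ∈ r.delivered u ∧ (m.dst, u) ∈ Q
    · obtain ⟨u, hu⟩ := h
      exact ⟨u, mem_silenced_delivered.2 (Or.inl hu)⟩
    · push Not at h
      refine ⟨_, mem_silenced_delivered.2 (Or.inr ⟨⟨hm, ?_⟩, h, rfl⟩)⟩
      -- A positive lower bound puts the postponed receipt strictly after sending, as the recursive
      -- construction requires.
      have := γ.one_le_lo _ _ hm.1
      have := le_max_right (T + 1) (m.sentAt + γ.lo m.src m.dst)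
      omega

theorem silenced_active {n : P × ℕ} (hn : n.2 ≤ T) (h : (silenced p γ r T Q).Active n) :
    n ∈ Q ∧ r.Active n := by
  rcases h with ⟨x, hx⟩ | ⟨m, hm, hd⟩
  · have := mem_of_mem_silenced_input hx
    exact ⟨this.1, Or.inl ⟨x, this.2⟩⟩
  · have := (mem_silenced_delivered_of_le hn).1 hd
    refine ⟨?_, Or.inr ⟨m, hm, this.1⟩⟩
    rw [hm] at this
    exact this.2

theorem ndOccursAt_of_silenced {j : P} {s : ℕ} (hs : s ≤ T) {e : Event P X M}
    (h : NDOccursAt γ (silenced p γ r T Q) j s e) : NDOccursAt γ r j s e := by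
  cases e with
  | input i x => exact ⟨h.1, (mem_of_mem_silenced_input h.2).2⟩
  | receive m => exact ⟨⟨h.1.1, ((mem_silenced_delivered_of_le hs).1 h.1.2).1⟩, h.2⟩

/-- Up to `T` the silenced run delivers only what `r` delivers at the same time. That the silenced
run is a run bounds the intermediate nodes by `T`. -/
theorem happenedBefore_of_silenced (hrun : IsRun p γ (silenced p γ r T Q)) {a b : P × ℕ}
    (h : HappenedBefore (silenced p γ r T Q) a b) (hb : b.2 ≤ T) : HappenedBefore r a b := by
  induction h with
  | loc i t t' h => exact .loc i t t' h
  | msg m t hm => exact .msg m t ((mem_silenced_delivered_of_le hb).1 hm).1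
  | trans a b c _ hbc h₁ h₂ =>
    exact .trans _ _ _ (h₁ ((HappenedBefore.time_le hrun hbc).trans hb)) (h₂ hb)

end Silence

/-! ### Nested knowledge and the causal chain -/

/-- What is known, to any depth, is true. -/
theorem NestedKnows.holds {R : Set (Run P X M A S)} {i : ℕ → P} {φ : Run P X M A S → ℕ → Prop}
    {k : ℕ} {r : Run P X M A S} (hr : r ∈ R) {t : ℕ} (h : NestedKnows R i k φ r t) : φ r t := by
  induction k with
  | zero => exact h
  | succ k ih => exact ih (h r hr t rfl)

/-- Nested knowledge of a nondeterministic event rests on a causal chain of active nodes. -/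
theorem exists_active_chain {γ : Context P X M A S} (hγ : γ.IsAsynch) {p : Protocol P M A S}
    {e : Event P X M} {i : ℕ → P} {t t' : ℕ} (k : ℕ) {r : Run P X M A S} (hr : IsRun p γ r)
    (he : NDOccursAt γ r (i 0) t e) (hK : NestedKnows (system p γ) i k (ndocc γ e) r t') :
    ∃ τ : ℕ → ℕ, τ 0 = t ∧
      (∀ h < k, HappenedBefore r (i h, τ h) (i (h + 1), τ (h + 1))) ∧
      (∀ h ≤ k, r.Active (i h, τ h) ∧ t ≤ τ h ∧ τ h ≤ t') := by
  induction k generalizing r with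
  | zero =>
    obtain ⟨j, s, hs, hj⟩ := NestedKnows.holds hr hK
    obtain ⟨-, rfl⟩ := he.unique hr hj
    refine ⟨fun _ => t, rfl, by simp, fun h hh => ?_⟩
    obtain rfl : h = 0 := by omega
    exact ⟨he.active, le_rfl, hs⟩
  | succ k ih =>
    set Q : Set (P × ℕ) := {n | HappenedBefore r n (i (k + 1), t')}
    have hQ : IsCausalPast r t' Q := isCausalPast_setOf_happenedBefore hr _ _
    have hrun := isRun_silenced hγ hr hQ
    have hK' := hK _ hrun t' (silenced_localState_of_mem hr hQ (.loc _ _ _ le_rfl))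
    -- Knowledge is truthful, so `e` occurs in the silenced run, hence at the same node of `r`; by
    -- uniqueness that node is `(i 0, t)`.
    obtain ⟨j, s, hs, hj⟩ := NestedKnows.holds hrun hK'
    obtain ⟨rfl, rfl⟩ := he.unique hr (ndOccursAt_of_silenced hs hj)
    obtain ⟨τ, h0, hchain, hτ⟩ := ih hrun hj hK'
    have hk := hτ k le_rfl
    have hq := silenced_active hk.2.2 hk.1
    -- The node `(i (k + 1), t')` may be inactive; an earlier or equal active one keeps the
    -- induction going.
    obtain ⟨s, hs, hact, hlast⟩ := HappenedBefore.exists_active hq.1 hq.2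
    refine ⟨Function.update τ (k + 1) s, ?_, fun h hh => ?_, fun h hh => ?_⟩
    · rw [Function.update_of_ne (by omega), h0]
    · rw [Function.update_of_ne (by omega : h ≠ k + 1)]
      rcases Nat.lt_succ_iff_lt_or_eq.1 hh with hlt | rfl
      · rw [Function.update_of_ne (by omega : h + 1 ≠ k + 1)]
        exact happenedBefore_of_silenced hrun (hchain h hlt) (hτ (h + 1) hlt).2.2
      · rwa [Function.update_self]
    · rcases Nat.le_succ_iff.1 hh with hle | rfl
      · rw [Function.update_of_ne (by omega)]
        exact ⟨(silenced_active (hτ h hle).2.2 (hτ h hle).1).2, (hτ h hle).2⟩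
      · rw [Function.update_self]
        exact ⟨hact, hk.2.1.trans (HappenedBefore.time_le hr hlast), hs⟩

end

end KnowledgeGain

theorem mainTheorem7 {P X M A S : Type*}
    (γ : KnowledgeGain.Context P X M A S) (hγ : γ.IsAsynch)
    (p : KnowledgeGain.Protocol P M A S)
    (r : KnowledgeGain.Run P X M A S) (hr : r ∈ KnowledgeGain.system p γ)
    (e : KnowledgeGain.Event P X M) (k : ℕ) (i : ℕ → P) (t t' : ℕ)
    (he : KnowledgeGain.NDOccursAt γ r (i 0) t e)
    (hK : KnowledgeGain.NestedKnows (KnowledgeGain.system p γ) i k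
      (KnowledgeGain.ndocc γ e) r t') :
    ∃ τ : ℕ → ℕ, τ 0 = t ∧
      (∀ h < k, KnowledgeGain.HappenedBefore r (i h, τ h) (i (h + 1), τ (h + 1))) ∧
      (∀ h ≤ k, t ≤ τ h ∧ τ h ≤ t') := by
  obtain ⟨τ, h0, hchain, hτ⟩ := KnowledgeGain.exists_active_chain hγ k hr he hK
  exact ⟨τ, h0, hchain, fun h hh => (hτ h hh).2⟩
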